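/- Let $p$ be a prime and let $G$ be a pro-$p$ group, that is, a compact Hausdorff topological group which is the projective limit of its quotients $G/N$, where $N$ runs through the closed normal subgroups for which $G/N$ is a finite $p$-group. Write $x^y=y^{-1}xy$. Let $G\widehat\otimes G$ be the complete nonabelian tensor square of $G$: the pro-$p$ group topologically generated by symbols $x\widehat\otimes y$ ($x,y\in G$), depending continuously on $(x,y)$, subject to the relations $$xy\,\widehat\otimes\, z=(x^y\widehat\otimes z^y)(y\widehat\otimes z),\qquad y\,\widehat\otimes\, tz=(y\widehat\otimes z)(y^z\widehat\otimes t^z)\qquad(x,y,z,t\in G).$$ Let $\widehat\nabla(G)$ be the closed (normal) subgroup of $G\widehat\otimes G$ generated by all $x\widehat\otimes x$, let $G\widehat\wedge G=(G\widehat\otimes G)/\widehat\nabla(G)$ be the complete nonabelian exterior square, and let $x\widehat\wedge y$ be the image of $x\widehat\otimes y$ in it. Let $Z(G)$ be the center of $G$, let $\widehat Z(G)=\{g\in G : g\widehat\wedge y=1\text{ for all }y\in G\}$ be the complete exterior center, which is a normal subgroup of $G$, and let $$\widehat{\mathrm d}(G)=(\mu\times\mu)\big(\{(x,y)\in G\times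 G : x\widehat\wedge y=1\}\big)$$ be the exterior degree, where $\mu$ is the normalized Haar measure of $G$. Let $\mathrm{rk}(G)$ be the supremum, over all closed subgroups $H$ of $G$, of the minimal number of topological generators of $H$. Let $C_p$ be the cyclic group of order $p$. Then: (i) If $G$ is abelian and $\mathrm{rk}(G)>1$ (possibly $\mathrm{rk}(G)=\infty$), then $\widehat{\mathrm d}(G)\le \dfrac{p^2+p-1}{p^3}$, and equality holds if and only if $G/\widehat Z(G)\cong C_p\times C_p$. (ii) If $G$ is nonabelian and $\widehat Z(G)\neq Z(G)$, then $\widehat{\mathrm d}(G)\le \dfrac{p^3+p-1}{p^4}$. -/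

import Mathlib

noncomputable section

namespace ProPExterior

open MeasureTheory Topology

/-! ### Pro-`p` groups and their rank -/

section Basic

variable (p : ℕ) (G : Type*) [Group G] [TopologicalSpace G]

/-- The closed normal subgroups `N` of `G` for which `G ⧸ N` is a finite `p`-group, that is
(for a prime `p`) for which the index of `N` is a power of `p`. -/
def openBasis : Set (Subgroup G) :=
  {N | IsClosed (N : Set G) ∧ N.Normal ∧ ∃ k : ℕ, N.index = p ^ k}

/-- A compact Hausdorff group `G` is a pro-`p` group if it is the projective limit of the
groups `G ⧸ N`, for `N` in `openBasis p G`: the canonical map from `G` to the set of compatible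
families of cosets is bijective. (As `G` is compact and the limit is Hausdorff, the continuous
canonical map is then an isomorphism of topological groups.) -/
def IsProP [IsTopologicalGroup G] [CompactSpace G] [T2Space G] : Prop :=
  ∀ a : (∀ N : openBasis p G, G ⧸ (N : Subgroup G)),
    (∀ (N M : openBasis p G) (h : (N : Subgroup G) ≤ (M : Subgroup G)),
      Subgroup.quotientMapOfLE h (a N) = a M) →
    ∃! g : G, ∀ N : openBasis p G, (QuotientGroup.mk g : G ⧸ (N : Subgroup G)) = a N

variable {G} in
/-- The least number of topological generators of a closed subgroup `H` (`⊤` if `H` is not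
topologically finitely generated). -/
def minTopGens [IsTopologicalGroup G] (H : ClosedSubgroup G) : ℕ∞ :=
  ⨅ (S : Set G) (_ : (Subgroup.closure S).topologicalClosure = H.toSubgroup), S.encard

/-- The rank of `G`: the supremum, over all closed subgroups `H`, of the least number of
topological generators of `H`. -/
def rank [IsTopologicalGroup G] : ℕ∞ := ⨆ H : ClosedSubgroup G, minTopGens H

end Basic

/-! ### The nonabelian tensor square of an abstract group -/

section Tensor

variable (G : Type*) [Group G]

/-- The defining relations of the nonabelian tensor square, where `x ^ y = y⁻¹ * x * y`:
`xy ⊗ z = (x ^ y ⊗ z ^ y) (y ⊗ z)` and `y ⊗ tz = (y ⊗ z) (y ^ z ⊗ t ^ z)`. -/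
def tensorRels : Set (FreeGroup (G × G)) :=
  {r | ∃ x y z : G, r = FreeGroup.of (x * y, z) *
      (FreeGroup.of (y⁻¹ * x * y, y⁻¹ * z * y) * FreeGroup.of (y, z))⁻¹} ∪
  {r | ∃ y t z : G, r = FreeGroup.of (y, t * z) *
      (FreeGroup.of (y, z) * FreeGroup.of (z⁻¹ * y * z, z⁻¹ * t * z))⁻¹}

/-- The (abstract) nonabelian tensor square of `G`. -/
abbrev TensorSquare : Type _ := PresentedGroup (tensorRels G)

variable {G}

/-- The symbol `x ⊗ y` in the abstract nonabelian tensor square. -/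
def tensor (x y : G) : TensorSquare G := PresentedGroup.of (x, y)

lemma tensor_mul_left (x y z : G) :
    tensor (x * y) z = tensor (y⁻¹ * x * y) (y⁻¹ * z * y) * tensor y z :=
  mul_inv_eq_one.mp <|
    (PresentedGroup.one_of_mem (rels := tensorRels G) (Or.inl ⟨x, y, z, rfl⟩))

lemma tensor_mul_right (y t z : G) :
    tensor y (t * z) = tensor y z * tensor (z⁻¹ * y * z) (z⁻¹ * t * z) :=
  mul_inv_eq_one.mp <|
    (PresentedGroup.one_of_mem (rels := tensorRels G) (Or.inr ⟨y, t, z, rfl⟩))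

end Tensor

/-! ### The complete nonabelian tensor and exterior squares -/

section Complete

variable (p : ℕ) (G : Type*) [Group G] [TopologicalSpace G]

/-- A normal subgroup `K` of the abstract tensor square such that the quotient is a finite
`p`-group, and such that `(x, y) ↦ x ⊗ y` becomes continuous as a map from `G × G` to this
(discrete) quotient. -/
structure Admissible where
  toSubgroup : Subgroup (TensorSquare G)
  normal : toSubgroup.Normal
  index_eq : ∃ k : ℕ, toSubgroup.index = p ^ k
  locallyConstant : IsLocallyConstant
    fun q : G × G => (QuotientGroup.mk (tensor q.1 q.2) : TensorSquare G ⧸ toSubgroup)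

variable {p G}

instance (K : Admissible p G) : K.toSubgroup.Normal := K.normal

/-- The finite quotient of the abstract tensor square by `K`, as a discrete group. -/
def FinQuot (K : Admissible p G) : Type _ := TensorSquare G ⧸ K.toSubgroup

instance (K : Admissible p G) : Group (FinQuot K) :=
  inferInstanceAs (Group (TensorSquare G ⧸ K.toSubgroup))

instance (K : Admissible p G) : TopologicalSpace (FinQuot K) := ⊥

instance (K : Admissible p G) : DiscreteTopology (FinQuot K) := ⟨rfl⟩

/-- The canonical map from the abstract tensor square to the product of all its
admissible finite quotients. -/
def toProd : TensorSquare G →* (∀ K : Admissible p G, FinQuot K) :=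
  MonoidHom.pi fun K => QuotientGroup.mk' K.toSubgroup

variable (p G)

/-- The complete nonabelian tensor square: the pro-`p` group topologically generated by the
symbols `x ⊗ y`, subject to the defining relations of the tensor square and to continuity in
`(x, y)`. It is realised as the closed subgroup generated by the symbols in the product of all
finite `p`-groups that are generated by such symbols. -/
def complTensorSubgroup : Subgroup (∀ K : Admissible p G, FinQuot K) :=
  (Subgroup.closure (Set.range fun q : G × G => toProd (tensor q.1 q.2))).topologicalClosure

/-- The complete nonabelian tensor square, as a topological group. -/
abbrev ComplTensor : Type _ := complTensorSubgroup p G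

variable {G}

/-- The symbol `x ⊗ y` in the complete nonabelian tensor square. -/
def ctensor (x y : G) : ComplTensor p G :=
  ⟨toProd (tensor x y), Subgroup.le_topologicalClosure _ (Subgroup.subset_closure ⟨(x, y), rfl⟩)⟩

variable {p}

lemma ctensor_mul_left (x y z : G) :
    ctensor p (x * y) z = ctensor p (y⁻¹ * x * y) (y⁻¹ * z * y) * ctensor p y z :=
  Subtype.ext <| by simp only [ctensor, Subgroup.coe_mul, tensor_mul_left x y z, map_mul]

lemma ctensor_mul_right (y t z : G) :
    ctensor p y (t * z) = ctensor p y z * ctensor p (z⁻¹ * y * z) (z⁻¹ * t * z) :=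
  Subtype.ext <| by simp only [ctensor, Subgroup.coe_mul, tensor_mul_right y t z, map_mul]

lemma dense_closure_ctensor :
    Dense (Subgroup.closure (Set.range fun q : G × G => ctensor p q.1 q.2) :
      Set (ComplTensor p G)) := by
  rw [Subtype.dense_iff]
  intro t ht
  have himg : (fun u : ComplTensor p G => (u : ∀ K : Admissible p G, FinQuot K)) ''
      (Subgroup.closure (Set.range fun q : G × G => ctensor p q.1 q.2) : Set (ComplTensor p G)) =
      (Subgroup.closure (Set.range fun q : G × G => toProd (p := p) (tensor q.1 q.2)) :
        Set (∀ K : Admissible p G, FinQuot K)) := by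
    have h := MonoidHom.map_closure (complTensorSubgroup p G).subtype
      (Set.range fun q : G × G => ctensor p q.1 q.2)
    rw [← Set.range_comp] at h
    exact congrArg (fun L : Subgroup (∀ K : Admissible p G, FinQuot K) =>
      (L : Set (∀ K : Admissible p G, FinQuot K))) h
  have ht' : t ∈ closure (Subgroup.closure (Set.range fun q : G × G =>
      toProd (p := p) (tensor q.1 q.2)) : Set (∀ K : Admissible p G, FinQuot K)) := ht
  rwa [← himg] at ht'

/-- Conjugation of symbols: `(a ⊗ c) ^ (b ⊗ d) = a ^ [b,d] ⊗ c ^ [b,d]`, in an equivalent form. -/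
lemma ctensor_conj (a b c d : G) :
    ctensor p ((d * b)⁻¹ * a * (d * b)) ((d * b)⁻¹ * c * (d * b)) * ctensor p b d =
      ctensor p b d * ctensor p ((b * d)⁻¹ * a * (b * d)) ((b * d)⁻¹ * c * (b * d)) := by
  have h1 := ctensor_mul_left (p := p) a b (c * d)
  have h2 := ctensor_mul_right (p := p) (a * b) c d
  rw [ctensor_mul_right b c d,
    show b⁻¹ * (c * d) * b = (b⁻¹ * c * b) * (b⁻¹ * d * b) by group,
    ctensor_mul_right (b⁻¹ * a * b)] at h1
  rw [ctensor_mul_left a b d,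
    show d⁻¹ * (a * b) * d = (d⁻¹ * a * d) * (d⁻¹ * b * d) by group,
    ctensor_mul_left (d⁻¹ * a * d)] at h2
  have e1 : ∀ x : G, (b⁻¹ * d * b)⁻¹ * (b⁻¹ * x * b) * (b⁻¹ * d * b) =
      (d * b)⁻¹ * x * (d * b) := fun x => by group
  have e2 : ∀ x : G, (d⁻¹ * b * d)⁻¹ * (d⁻¹ * x * d) * (d⁻¹ * b * d) =
      (b * d)⁻¹ * x * (b * d) := fun x => by group
  rw [e1, e1] at h1
  rw [e2, e2] at h2
  have h3 := h1.symm.trans h2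
  refine mul_left_cancel (a := ctensor p (b⁻¹ * a * b) (b⁻¹ * d * b))
    (mul_right_cancel (b := ctensor p (d⁻¹ * b * d) (d⁻¹ * c * d)) ?_)
  simpa only [← mul_assoc] using h3

variable (p G)

/-- The closed subgroup of the complete tensor square generated by all the `x ⊗ x`. -/
def nabla : Subgroup (ComplTensor p G) :=
  (Subgroup.closure (Set.range fun x : G => ctensor p x x)).topologicalClosure

instance nabla_normal : (nabla p G).Normal := by
  set A : Subgroup (ComplTensor p G) := Subgroup.closure (Set.range fun x : G => ctensor p x x)
    with hA
  have hAn : nabla p G = A.topologicalClosure := rfl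
  have key : Subgroup.closure (Set.range fun q : G × G => ctensor p q.1 q.2) ≤
      Subgroup.normalizer (A : Set (ComplTensor p G)) := by
    have hconj : ∀ b d : G,
        (∀ n ∈ A, ctensor p b d * n * (ctensor p b d)⁻¹ ∈ A) ∧
        (∀ n ∈ A, (ctensor p b d)⁻¹ * n * ctensor p b d ∈ A) := by
      intro b d
      constructor
      · have : A ≤ A.comap (MulAut.conj (ctensor p b d)).toMonoidHom := by
          rw [hA, Subgroup.closure_le]
          rintro _ ⟨x, rfl⟩
          have h := ctensor_conj (p := p) ((b * d) * x * (b * d)⁻¹) b ((b * d) * x * (b * d)⁻¹) d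
          rw [show (b * d)⁻¹ * ((b * d) * x * (b * d)⁻¹) * (b * d) = x by group] at h
          simp only [Subgroup.coe_comap, Set.mem_preimage, MulEquiv.coe_toMonoidHom,
            MulAut.conj_apply, SetLike.mem_coe]
          rw [← h, mul_inv_cancel_right]
          exact Subgroup.subset_closure ⟨_, rfl⟩
        exact fun n hn => this hn
      · have : A ≤ A.comap (MulAut.conj (ctensor p b d)⁻¹).toMonoidHom := by
          rw [hA, Subgroup.closure_le]
          rintro _ ⟨x, rfl⟩
          have h := ctensor_conj (p := p) ((d * b) * x * (d * b)⁻¹) b ((d * b) * x * (d * b)⁻¹) d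
          rw [show (d * b)⁻¹ * ((d * b) * x * (d * b)⁻¹) * (d * b) = x by group] at h
          simp only [Subgroup.coe_comap, Set.mem_preimage, MulEquiv.coe_toMonoidHom,
            MulAut.conj_apply, SetLike.mem_coe, inv_inv]
          rw [mul_assoc, h, inv_mul_cancel_left]
          exact Subgroup.subset_closure ⟨_, rfl⟩
        intro n hn
        simpa using this hn
    rw [Subgroup.closure_le]
    rintro _ ⟨⟨b, d⟩, rfl⟩
    rw [SetLike.mem_coe, Subgroup.mem_normalizer_iff]
    refine fun n => ⟨(hconj b d).1 n, fun h => ?_⟩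
    have := (hconj b d).2 _ h
    simpa [mul_assoc] using this
  have hdense : ∀ t : ComplTensor p G, ∀ n ∈ A, t * n * t⁻¹ ∈ A.topologicalClosure := by
    intro t n hn
    have hcl : IsClosed {t : ComplTensor p G | t * n * t⁻¹ ∈ A.topologicalClosure} :=
      A.isClosed_topologicalClosure.preimage
        (f := fun t : ComplTensor p G => t * n * t⁻¹) (by fun_prop)
    have hsub : closure (Subgroup.closure (Set.range fun q : G × G => ctensor p q.1 q.2) :
        Set (ComplTensor p G)) ⊆ {t | t * n * t⁻¹ ∈ A.topologicalClosure} :=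
      closure_minimal (fun t ht => A.le_topologicalClosure
        ((Subgroup.mem_normalizer_iff.mp (key ht) n).mp hn)) hcl
    exact hsub (dense_closure_ctensor t)
  refine ⟨fun n hn t => ?_⟩
  have hcl : IsClosed {n : ComplTensor p G | t * n * t⁻¹ ∈ A.topologicalClosure} :=
    A.isClosed_topologicalClosure.preimage
      (f := fun n : ComplTensor p G => t * n * t⁻¹) (by fun_prop)
  exact closure_minimal (fun n hn => hdense t n hn) hcl hn

/-- The complete nonabelian exterior square of `G`, with its quotient topology. -/
abbrev ComplExterior : Type _ := ComplTensor p G ⧸ nabla p G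

variable {G}

/-- The element `x ∧ y` of the complete nonabelian exterior square. -/
def wedge (x y : G) : ComplExterior p G := QuotientGroup.mk (ctensor p x y)

variable {p}

lemma wedge_mul_left (x y z : G) :
    wedge p (x * y) z = wedge p (y⁻¹ * x * y) (y⁻¹ * z * y) * wedge p y z := by
  simp only [wedge, ctensor_mul_left x y z, QuotientGroup.mk_mul]

lemma wedge_mul_right (y t z : G) :
    wedge p y (t * z) = wedge p y z * wedge p (z⁻¹ * y * z) (z⁻¹ * t * z) := by
  simp only [wedge, ctensor_mul_right y t z, QuotientGroup.mk_mul]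

lemma wedge_conj_eq_one {a : G} (ha : ∀ y : G, wedge p a y = 1) (z w : G) :
    wedge p (z⁻¹ * a * z) w = 1 := by
  have h := wedge_mul_right (p := p) a (z * w * z⁻¹) z
  rw [ha, ha, one_mul] at h
  rw [h]
  congr 1
  group

variable (p G)

/-- The complete exterior center of `G`: all `g` with `g ∧ y = 1` for every `y` in `G`. -/
def exteriorCenter : Subgroup G where
  carrier := {g | ∀ y : G, wedge p g y = 1}
  one_mem' := fun y => by
    have h := wedge_mul_left (p := p) 1 1 y
    simpa using h
  mul_mem' := fun {a b} ha hb y => by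
    rw [wedge_mul_left, hb y, wedge_conj_eq_one ha, one_mul]
  inv_mem' := fun {a} ha y => by
    have h := wedge_mul_left (p := p) a⁻¹ a (a * y * a⁻¹)
    rw [ha, mul_one, inv_mul_cancel] at h
    have h1 : ∀ z : G, wedge p 1 z = 1 := fun z => by
      have h := wedge_mul_left (p := p) 1 1 z
      simpa using h
    rw [h1] at h
    rw [h]
    congr 1 <;> group

instance exteriorCenter_normal : (exteriorCenter p G).Normal :=
  ⟨fun a ha z y => by
    have h := wedge_conj_eq_one (p := p) (a := a) ha z⁻¹ y
    rwa [inv_inv] at h⟩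

/-! ### The exterior degree -/

/-- The normalized Haar measure of a compact group. -/
def haarProb [IsTopologicalGroup G] [CompactSpace G] [MeasurableSpace G] [BorelSpace G] :
    Measure G := Measure.haarMeasure ⊤

/-- The exterior degree of `G`: the measure, for the product of the normalized Haar measure of
`G` with itself, of the set of all `(x, y)` with `x ∧ y = 1`. -/
def exteriorDegree [IsTopologicalGroup G] [CompactSpace G] [MeasurableSpace G] [BorelSpace G] :
    ℝ :=
  ((haarProb G).prod (haarProb G)).real {q : G × G | wedge p q.1 q.2 = 1}

end Complete

end ProPExterior

end

namespace ProPExterior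

open MeasureTheory Topology

/-! ### Open normal subgroups of pro-`p` groups -/

section OpenBasis

variable {p : ℕ} {G : Type*} [Group G] [TopologicalSpace G]

/-! The exterior degree is bounded above by continuous alternating pairings `f` from `G × G` to
finite `p`-groups. These are exactly what the exterior square can see: such an `f` vanishes wherever
`wedge` does (`IsAltPairing.eq_one_of_wedge`), and they detect every nontrivial symbol
(`exists_isAltPairing_ne_one`). For fixed `x`, the `y` with `x ∧ y = 1` lie in the open subgroup
`perp x`, whose index is a power of `p` and equals `1` only for `x` in the radical of `f`. If the
radical has index `r`, integrating over `x` bounds the degree by `1/r + (1 - 1/r)/p`, which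
decreases as `r` grows.

In the abelian case, rank above one gives a surjection `φ` onto `C_p × C_p`. The determinant pairing
of `φ` has radical `φ.ker`, so `r = p ^ 2`. In the nonabelian case, the commutator pairing modulo a
suitable open normal subgroup has `r ≥ p ^ 2`, because a central quotient of a nonabelian group is
not cyclic. A central element outside the exterior center lies in that radical; pairing the
commutator with some `f` that detects this element shrinks the radical, so `r ≥ p ^ 3`.

The same refinement settles equality: if the exterior center is smaller than `φ.ker`, the strictly
smaller `p ^ 3` bound applies. If they coincide, the determinant decides when a symbol is trivial
and the degree can be bounded below. -/

lemma index_eq_pow_of_le [Fact p.Prime] {N H : Subgroup G} (hN : N ∈ openBasis p G) (h : N ≤ H) :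
    ∃ k : ℕ, H.index = p ^ k := by
  obtain ⟨-, -, k, hk⟩ := hN
  obtain ⟨j, -, hj⟩ := (Nat.dvd_prime_pow (Fact.out : p.Prime)).1 (hk ▸ Subgroup.index_dvd_of_le h)
  exact ⟨j, hj⟩

lemma inf_mem_openBasis [Fact p.Prime] {N M : Subgroup G} (hN : N ∈ openBasis p G)
    (hM : M ∈ openBasis p G) : N ⊓ M ∈ openBasis p G := by
  obtain ⟨hNc, hNn, k, hk⟩ := hN
  obtain ⟨hMc, hMn, l, hl⟩ := hM
  refine ⟨hNc.inter hMc, inferInstance, ?_⟩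
  have h1 : (N ⊓ M).index = M.relIndex N * N.index := by
    rw [← Subgroup.inf_relIndex_left, Subgroup.relIndex_mul_index inf_le_left]
  have h2 : M.relIndex N ∣ p ^ l := hl ▸ Subgroup.relIndex_dvd_index_of_normal M N
  obtain ⟨j, -, hj⟩ := (Nat.dvd_prime_pow (Fact.out : p.Prime)).1 h2
  exact ⟨j + k, by rw [h1, hj, hk, pow_add]⟩

lemma top_mem_openBasis : (⊤ : Subgroup G) ∈ openBasis p G :=
  ⟨isClosed_univ, inferInstance, 0, by simp⟩

variable [IsTopologicalGroup G]

lemma isOpen_of_mem_openBasis [Fact p.Prime] {N : Subgroup G} (hN : N ∈ openBasis p G) :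
    IsOpen (N : Set G) := by
  obtain ⟨hc, -, k, hk⟩ := hN
  have : N.FiniteIndex := ⟨by rw [hk]; exact pow_ne_zero _ (Fact.out : p.Prime).ne_zero⟩
  exact N.isOpen_of_isClosed_of_finiteIndex hc

variable [CompactSpace G] [T2Space G]

lemma IsProP.eq_one (hG : IsProP p G) {g : G} (hg : ∀ N ∈ openBasis p G, g ∈ N) : g = 1 := by
  obtain ⟨h, -, hu⟩ := hG (fun N => QuotientGroup.mk 1) fun N M hNM => rfl
  rw [hu g fun N => ?_, hu 1 fun N => rfl]
  exact QuotientGroup.eq.2 (by simpa using hg N N.2)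

/-- By compactness: the subgroups in `openBasis` are closed, directed downwards and meet only in
`1`. -/
lemma IsProP.exists_le_nhds [Fact p.Prime] (hG : IsProP p G) {U : Set G} (hU : U ∈ 𝓝 (1 : G)) :
    ∃ N ∈ openBasis p G, (N : Set G) ⊆ U := by
  have : Nonempty (openBasis p G) := ⟨⟨⊤, top_mem_openBasis⟩⟩
  obtain ⟨N, hN⟩ := exists_subset_nhds_of_compactSpace
    (V := fun N : openBasis p G => ((N : Subgroup G) : Set G))
    (fun N M => ⟨⟨_, inf_mem_openBasis N.2 M.2⟩, Set.inter_subset_left, Set.inter_subset_right⟩)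
    (fun N => N.2.1) (U := U) (fun g hg => by
      rw [hG.eq_one fun N hN => Set.mem_iInter.1 hg ⟨N, hN⟩]
      exact hU)
  exact ⟨N, N.2, hN⟩

/-- A locally constant function of two variables in a pro-`p` group is invariant under
translation by some open normal subgroup. -/
lemma IsProP.exists_invariant [Fact p.Prime] (hG : IsProP p G) {Q : Type*} {f : G → G → Q}
    (hf : IsLocallyConstant fun q : G × G => f q.1 q.2) :
    ∃ N ∈ openBasis p G, ∀ x y, ∀ n ∈ N, ∀ m ∈ N, f (x * n) (y * m) = f x y := by
  -- The equality holds for `z` near `1` locally in `w`; compactness of `G × G` makes the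
  -- neighbourhood of `1` uniform in `w`.
  have h : ∀ᶠ z in 𝓝 (1 : G × G), ∀ w ∈ (Set.univ : Set (G × G)),
      f (w * z).1 (w * z).2 = f w.1 w.2 := by
    refine isCompact_univ.eventually_forall_of_forall_eventually fun w _ => ?_
    have hc : IsLocallyConstant fun q : (G × G) × (G × G) =>
        (f (q.2 * q.1).1 (q.2 * q.1).2, f q.2.1 q.2.2) :=
      (hf.comp_continuous (continuous_snd.mul continuous_fst)).prodMk
        (hf.comp_continuous continuous_snd)
    filter_upwards [hc.eventually_eq (1, w)] with q hq
    have h1 := congrArg Prod.fst hq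
    have h2 := congrArg Prod.snd hq
    simp only [mul_one] at h1 h2
    exact h1.trans h2.symm
  rw [show (1 : G × G) = (1, 1) from rfl, nhds_prod_eq, Filter.eventually_iff,
    Filter.mem_prod_iff] at h
  obtain ⟨U, hU, V, hV, hUV⟩ := h
  obtain ⟨N, hN, hNU⟩ := hG.exists_le_nhds (Filter.inter_mem hU hV)
  exact ⟨N, hN, fun x y n hn m hm =>
    @hUV (n, m) ⟨(hNU hn).1, (hNU hm).2⟩ (x, y) (Set.mem_univ _)⟩

end OpenBasis

/-! ### Alternating pairings -/

/-- A crossed pairing `G × G → Q` (that is, a map satisfying the relations of the nonabelian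
tensor square) which is trivial on the diagonal. -/
structure IsAltPairing {G Q : Type*} [Group G] [Group Q] (f : G → G → Q) : Prop where
  mul_left : ∀ x y z, f (x * y) z = f (y⁻¹ * x * y) (y⁻¹ * z * y) * f y z
  mul_right : ∀ y t z, f y (t * z) = f y z * f (z⁻¹ * y * z) (z⁻¹ * t * z)
  self : ∀ x, f x x = 1

namespace IsAltPairing

section Algebra

variable {G Q : Type*} [Group G] [Group Q] {f : G → G → Q}

lemma one_left (hf : IsAltPairing f) (y : G) : f 1 y = 1 := by
  simpa using hf.mul_left 1 1 y

lemma one_right (hf : IsAltPairing f) (x : G) : f x 1 = 1 := by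
  simpa using hf.mul_right x 1 1

lemma conj (hf : IsAltPairing f) (w : G) :
    IsAltPairing fun x y => f (w⁻¹ * x * w) (w⁻¹ * y * w) where
  mul_left x y z := by
    have := hf.mul_left (w⁻¹ * x * w) (w⁻¹ * y * w) (w⁻¹ * z * w)
    convert this using 2
    · group
    · congr 1 <;> group
  mul_right y t z := by
    have := hf.mul_right (w⁻¹ * y * w) (w⁻¹ * t * w) (w⁻¹ * z * w)
    convert this using 2
    · group
    · congr 1 <;> group
  self x := hf.self _

lemma prod (hf : IsAltPairing f) {R : Type*} [Group R] {g : G → G → R} (hg : IsAltPairing g) :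
    IsAltPairing fun x y => (f x y, g x y) where
  mul_left x y z := Prod.ext (hf.mul_left x y z) (hg.mul_left x y z)
  mul_right x y z := Prod.ext (hf.mul_right x y z) (hg.mul_right x y z)
  self x := Prod.ext (hf.self x) (hg.self x)

/-- The commutator pairing modulo a normal subgroup. -/
lemma commutator (N : Subgroup G) [N.Normal] :
    IsAltPairing fun x y : G => (QuotientGroup.mk (x⁻¹ * y⁻¹ * x * y) : G ⧸ N) where
  mul_left x y z := by
    rw [← QuotientGroup.mk_mul]
    congr 1
    group
  mul_right x y z := by
    rw [← QuotientGroup.mk_mul]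
    congr 1
    group
  self x := by
    rw [show x⁻¹ * x⁻¹ * x * x = 1 by group]
    rfl

/-- The homomorphism from the tensor square induced by a pairing. -/
def lift (hf : IsAltPairing f) : TensorSquare G →* Q :=
  PresentedGroup.toGroup (rels := tensorRels G) (f := fun q : G × G => f q.1 q.2) (by
    rintro r (⟨x, y, z, rfl⟩ | ⟨y, t, z, rfl⟩)
    · simp only [map_mul, map_inv, FreeGroup.lift_apply_of]
      rw [hf.mul_left x y z, mul_inv_cancel]
    · simp only [map_mul, map_inv, FreeGroup.lift_apply_of]
      rw [hf.mul_right y t z, mul_inv_cancel])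

@[simp] lemma lift_tensor (hf : IsAltPairing f) (x y : G) : hf.lift (tensor x y) = f x y :=
  PresentedGroup.toGroup.of _

end Algebra

variable {p : ℕ} [Fact p.Prime] {G Q : Type*} [Group G] [TopologicalSpace G] [Group Q]
  {f : G → G → Q}

/-- A continuous alternating pairing with values in a finite `p`-group vanishes wherever the
symbol of the exterior square does. -/
lemma eq_one_of_wedge (hf : IsAltPairing f) [Finite Q] (hQ : IsPGroup p Q)
    (hc : IsLocallyConstant fun q : G × G => f q.1 q.2) {x y : G} (h : wedge p x y = 1) :
    f x y = 1 := by
  -- The kernel of the induced map is admissible, so its quotient is a coordinate of the product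
  -- containing `ComplTensor p G`.
  let K : Admissible p G :=
    { toSubgroup := hf.lift.ker
      normal := inferInstance
      index_eq := by
        rw [Subgroup.index_ker]
        exact (IsPGroup.iff_card).1 (hQ.to_subgroup _)
      locallyConstant := by
        rw [IsLocallyConstant.iff_eventually_eq] at hc ⊢
        intro q
        filter_upwards [hc q] with r hr
        apply QuotientGroup.kerLift_injective hf.lift
        simpa using hr }
  let π : ComplTensor p G →* FinQuot K :=
    (Pi.evalMonoidHom (fun K : Admissible p G => FinQuot K) K).comp
      (complTensorSubgroup p G).subtype
  have hπ : Continuous π := (continuous_apply K).comp continuous_subtype_val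
  have hπt : ∀ x y, π (ctensor p x y) = (QuotientGroup.mk (tensor x y) :
    TensorSquare G ⧸ K.toSubgroup) := fun x y => rfl
  have hle : nabla p G ≤ π.ker := by
    refine Subgroup.topologicalClosure_minimal _ ?_ ?_
    · rw [Subgroup.closure_le]
      rintro _ ⟨x, rfl⟩
      change π (ctensor p x x) = 1
      rw [hπt]
      exact (QuotientGroup.eq_one_iff _).2 ((hf.lift_tensor x x).trans (hf.self x))
    · exact isClosed_singleton.preimage hπ
  have h1 : π (ctensor p x y) = 1 := hle ((QuotientGroup.eq_one_iff _).1 h)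
  rw [hπt] at h1
  exact (hf.lift_tensor x y).symm.trans ((QuotientGroup.eq_one_iff (N := K.toSubgroup) _).1 h1)

end IsAltPairing

/-- Nontrivial symbols of the exterior square are detected by continuous alternating pairings with
values in finite `p`-groups. -/
lemma exists_isAltPairing_ne_one {p : ℕ} [Fact p.Prime] {G : Type*} [Group G] [TopologicalSpace G]
    {x y : G} (h : wedge p x y ≠ 1) :
    ∃ (W : Subgroup (ComplTensor p G)) (_ : W.Normal) (f : G → G → ComplTensor p G ⧸ W),
      Finite (ComplTensor p G ⧸ W) ∧ IsPGroup p (ComplTensor p G ⧸ W) ∧ IsAltPairing f ∧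
      IsLocallyConstant (fun q : G × G => f q.1 q.2) ∧ f x y ≠ 1 := by
  set t := ctensor p x y
  have htn : t ∉ nabla p G := fun hm => h ((QuotientGroup.eq_one_iff _).2 hm)
  have hopen : IsOpen ((nabla p G : Set (ComplTensor p G))ᶜ) :=
    (Subgroup.isClosed_topologicalClosure _).isOpen_compl
  obtain ⟨O, hO, hOeq⟩ := isOpen_induced_iff.1 hopen
  have htO : (t : ∀ K : Admissible p G, FinQuot K) ∈ O := by
    have : t ∈ ((nabla p G : Set (ComplTensor p G))ᶜ) := htn
    rwa [← hOeq] at this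
  -- A basic neighbourhood of `t` avoiding `nabla` constrains only the finitely many coordinates in
  -- `I`, so `π` has a finite `p`-group as target.
  obtain ⟨I, u, hu, hIsub⟩ := isOpen_pi_iff.1 hO _ htO
  let π : ComplTensor p G →* (∀ K : I, FinQuot K.1) :=
    (MonoidHom.pi fun K : I => Pi.evalMonoidHom (fun K : Admissible p G => FinQuot K) K.1).comp
      (complTensorSubgroup p G).subtype
  have hcard : ∀ K : Admissible p G, ∃ k, Nat.card (FinQuot K) = p ^ k := fun K => K.index_eq
  have hfinQ : ∀ K : Admissible p G, Finite (FinQuot K) := fun K => by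
    obtain ⟨k, hk⟩ := hcard K
    exact Nat.finite_of_card_ne_zero (by rw [hk]; exact pow_ne_zero _ (Fact.out : p.Prime).ne_zero)
  have hpi : ∃ k, Nat.card (∀ K : I, FinQuot K.1) = p ^ k := by
    choose k hk using hcard
    refine ⟨∑ K : I, k K.1, ?_⟩
    rw [Nat.card_pi, ← Finset.prod_pow_eq_pow_sum]
    exact Finset.prod_congr rfl fun K _ => hk K.1
  have hker : ∃ k, π.ker.index = p ^ k := by
    rw [Subgroup.index_ker]
    exact IsPGroup.iff_card.1 ((IsPGroup.iff_card.2 hpi).to_subgroup _)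
  set W : Subgroup (ComplTensor p G) := nabla p G ⊔ π.ker
  have hWn : W.Normal := inferInstance
  have hWi : ∃ k, W.index = p ^ k := by
    obtain ⟨k, hk⟩ := hker
    obtain ⟨j, -, hj⟩ := (Nat.dvd_prime_pow (Fact.out : p.Prime)).1
      (hk ▸ Subgroup.index_dvd_of_le (le_sup_right : π.ker ≤ W))
    exact ⟨j, hj⟩
  have hfin : Finite (ComplTensor p G ⧸ W) := by
    obtain ⟨k, hk⟩ := hWi
    exact Nat.finite_of_card_ne_zero
      (show W.index ≠ 0 by rw [hk]; exact pow_ne_zero _ (Fact.out : p.Prime).ne_zero)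
  refine ⟨W, hWn, fun a b => QuotientGroup.mk (ctensor p a b), hfin, IsPGroup.iff_card.2 hWi,
    ⟨fun a b c => ?_, fun a b c => ?_, fun a => ?_⟩, ?_, ?_⟩
  · rw [ctensor_mul_left]; rfl
  · rw [ctensor_mul_right]; rfl
  · exact (QuotientGroup.eq_one_iff _).2 (le_sup_left (a := nabla p G) (b := π.ker)
      (Subgroup.le_topologicalClosure _ (Subgroup.subset_closure ⟨a, rfl⟩)))
  · rw [IsLocallyConstant.iff_eventually_eq]
    intro q
    have : ∀ᶠ r in 𝓝 q, ∀ K : I, (QuotientGroup.mk (tensor r.1 r.2) :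
        TensorSquare G ⧸ K.1.toSubgroup) = QuotientGroup.mk (tensor q.1 q.2) :=
      Filter.eventually_all.2 fun K => K.1.locallyConstant.eventually_eq q
    filter_upwards [this] with r hr
    refine QuotientGroup.eq.2 (le_sup_right (a := nabla p G) (b := π.ker) ?_)
    rw [MonoidHom.mem_ker, map_mul, map_inv, inv_mul_eq_one]
    exact funext hr
  · intro h1
    -- Otherwise some `n` in `nabla` would agree with `t` on `I`, and so lie in `O`, which avoids
    -- `nabla`.
    have h2 : t ∈ W := (QuotientGroup.eq_one_iff _).1 h1
    obtain ⟨n, hn, v, hv, hnv⟩ := Subgroup.mem_sup_of_normal_right.1 h2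
    have hnt : π n = π t := by rw [← hnv, map_mul, MonoidHom.mem_ker.1 hv, mul_one]
    have : n ∈ ((nabla p G : Set (ComplTensor p G))ᶜ) := by
      rw [← hOeq]
      refine hIsub fun K hK => ?_
      have h3 := congrFun hnt ⟨K, hK⟩
      have h4 : (n : ∀ K : Admissible p G, FinQuot K) K =
        (t : ∀ K : Admissible p G, FinQuot K) K := h3
      rw [h4]
      exact (hu K hK).2
    exact this hn

/-! ### Orthogonal subgroups and the radical of a pairing -/

namespace IsAltPairing

variable {G Q : Type*} [Group G] [Group Q] {f : G → G → Q}

/-- The elements `y` such that `f` is trivial on all the simultaneous conjugates of `(x, y)`. -/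
def perp (hf : IsAltPairing f) (x : G) : Subgroup G where
  carrier := {y | ∀ w : G, f (w⁻¹ * x * w) (w⁻¹ * y * w) = 1}
  one_mem' w := by
    rw [mul_one, inv_mul_cancel]
    exact hf.one_right _
  -- Quantifying over `w` absorbs the twist in `mul_right`: the twisted factor is the pair
  -- conjugated by `z * w`.
  mul_mem' {t z} ht hz w := by
    have h := hf.mul_right (w⁻¹ * x * w) (w⁻¹ * t * w) (w⁻¹ * z * w)
    rw [hz w, show (w⁻¹ * z * w)⁻¹ * (w⁻¹ * x * w) * (w⁻¹ * z * w) =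
      (z * w)⁻¹ * x * (z * w) by group, show (w⁻¹ * z * w)⁻¹ * (w⁻¹ * t * w) * (w⁻¹ * z * w) =
      (z * w)⁻¹ * t * (z * w) by group, ht, one_mul] at h
    rw [← h]
    congr 1
    group
  inv_mem' {z} hz w := by
    -- With `w = z * u`, the twisted factor in the expansion of `z⁻¹ * z` conjugated by `u` is
    -- exactly the value sought.
    obtain ⟨u, rfl⟩ : ∃ u, w = z * u := ⟨z⁻¹ * w, by group⟩
    have h := hf.mul_right (u⁻¹ * x * u) (u⁻¹ * z⁻¹ * u) (u⁻¹ * z * u)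
    rw [hz u, show u⁻¹ * z⁻¹ * u * (u⁻¹ * z * u) = 1 by group, hf.one_right, one_mul] at h
    rw [h]
    congr 1 <;> group

/-- The elements orthogonal to the whole group, together with all their conjugates. -/
def radical (hf : IsAltPairing f) : Subgroup G where
  carrier := {x | ∀ y w : G, f (w⁻¹ * x * w) y = 1}
  one_mem' y w := by
    rw [mul_one, inv_mul_cancel]
    exact hf.one_left _
  mul_mem' {a b} ha hb y w := by
    have h := hf.mul_left (w⁻¹ * a * w) (w⁻¹ * b * w) y
    rw [hb, mul_one, show (w⁻¹ * b * w)⁻¹ * (w⁻¹ * a * w) * (w⁻¹ * b * w) =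
      (b * w)⁻¹ * a * (b * w) by group, ha] at h
    rw [← h]
    congr 1
    group
  inv_mem' {a} ha y w := by
    obtain ⟨u, rfl⟩ : ∃ u, w = a * u := ⟨a⁻¹ * w, by group⟩
    have h := hf.mul_left (u⁻¹ * a⁻¹ * u) (u⁻¹ * a * u)
      ((u⁻¹ * a * u) * y * (u⁻¹ * a * u)⁻¹)
    rw [ha, mul_one, show u⁻¹ * a⁻¹ * u * (u⁻¹ * a * u) = 1 by group, hf.one_left] at h
    rw [h]
    congr 1 <;> group

lemma mem_radical (hf : IsAltPairing f) {x : G} :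
    x ∈ hf.radical ↔ ∀ y w : G, f (w⁻¹ * x * w) y = 1 := Iff.rfl

lemma perp_eq_top_iff (hf : IsAltPairing f) {x : G} : hf.perp x = ⊤ ↔ x ∈ hf.radical := by
  rw [Subgroup.eq_top_iff', mem_radical]
  refine ⟨fun h y w => ?_, fun h y w => h _ _⟩
  have := h (w * y * w⁻¹) w
  rwa [show w⁻¹ * (w * y * w⁻¹) * w = y by group] at this

section Invariant

variable {N : Subgroup G} [N.Normal]
  (hN : ∀ x y, ∀ n ∈ N, ∀ m ∈ N, f (x * n) (y * m) = f x y)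

include hN

lemma le_perp (hf : IsAltPairing f) (x : G) : N ≤ hf.perp x := fun n hn w => by
  have := hN (w⁻¹ * x * w) 1 1 N.one_mem (w⁻¹ * n * w)
    (by simpa using ‹N.Normal›.conj_mem n hn w⁻¹)
  rwa [mul_one, one_mul, hf.one_right] at this

lemma le_radical (hf : IsAltPairing f) : N ≤ hf.radical := fun n hn y w => by
  have := hN 1 y (w⁻¹ * n * w) (by simpa using ‹N.Normal›.conj_mem n hn w⁻¹) 1 N.one_mem
  rwa [mul_one, one_mul, hf.one_left] at this

lemma perp_mul (hf : IsAltPairing f) (x : G) {n : G} (hn : n ∈ N) :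
    hf.perp (x * n) = hf.perp x := by
  ext y
  refine forall_congr' fun w => ?_
  have := hN (w⁻¹ * x * w) (w⁻¹ * y * w) (w⁻¹ * n * w)
    (by simpa using ‹N.Normal›.conj_mem n hn w⁻¹) 1 N.one_mem
  rw [← this, mul_one, show w⁻¹ * x * w * (w⁻¹ * n * w) = w⁻¹ * (x * n) * w by group]

end Invariant

end IsAltPairing

/-- A pairing detecting the conjugated symbol becomes, after precomposition with conjugation, one
detecting the original symbol. No action on the exterior square is needed. -/
lemma wedge_conj {p : ℕ} [Fact p.Prime] {G : Type*} [Group G] [TopologicalSpace G]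
    [IsTopologicalGroup G] {x y : G} (h : wedge p x y = 1) (w : G) :
    wedge p (w⁻¹ * x * w) (w⁻¹ * y * w) = 1 := by
  by_contra hne
  obtain ⟨W, hW, f, hfin, hp, hf, hc, hfne⟩ := exists_isAltPairing_ne_one hne
  exact hfne ((hf.conj w).eq_one_of_wedge hp (hc.comp_continuous
    (f := fun q : G × G => (w⁻¹ * q.1 * w, w⁻¹ * q.2 * w)) (by fun_prop)) h)

/-! ### Measures -/

section Measure

variable {p : ℕ} {G : Type*} [Group G] [TopologicalSpace G] [IsTopologicalGroup G]
  [CompactSpace G] [MeasurableSpace G] [BorelSpace G]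

instance : IsProbabilityMeasure (haarProb G) :=
  ⟨Measure.haarMeasure_self (K₀ := (⊤ : TopologicalSpace.PositiveCompacts G))⟩

instance : (haarProb G).IsMulLeftInvariant :=
  inferInstanceAs (Measure.haarMeasure _).IsMulLeftInvariant

lemma haarProb_real_subgroup {H : Subgroup G} (hH : IsOpen (H : Set G)) :
    (haarProb G).real H = (H.index : ℝ)⁻¹ := by
  have : Finite (G ⧸ H) := H.quotient_finite_of_isOpen hH
  have : H.FiniteIndex := Subgroup.finiteIndex_of_finite_quotient
  have h := H.index_mul_measure hH.measurableSet (haarProb G)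
  rw [measure_univ] at h
  have h2 := congrArg ENNReal.toReal h
  rw [ENNReal.toReal_mul, ENNReal.toReal_natCast, ENNReal.toReal_one] at h2
  exact eq_inv_of_mul_eq_one_right h2

/-- Fubini, with the trivial bound `1` on the slices over `Z`. -/
lemma prod_real_le {E : Set (G × G)} (hE : MeasurableSet E) {Z : Subgroup G}
    (hZ : IsOpen (Z : Set G)) {c : ℝ} (h0 : 0 ≤ c)
    (h : ∀ x ∉ Z, (haarProb G).real (Prod.mk x ⁻¹' E) ≤ c) :
    ((haarProb G).prod (haarProb G)).real E ≤
      (Z.index : ℝ)⁻¹ + (1 - (Z.index : ℝ)⁻¹) * c := by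
  have hle : ((haarProb G).prod (haarProb G)) E ≤
      haarProb G Z + ENNReal.ofReal c * haarProb G (Z : Set G)ᶜ := by
    rw [Measure.prod_apply hE, ← lintegral_add_compl _ hZ.measurableSet]
    refine add_le_add ?_ ?_
    · calc _ ≤ ∫⁻ x in (Z : Set G), 1 ∂haarProb G := lintegral_mono fun x => prob_le_one
        _ = _ := by simp
    · rw [← setLIntegral_const]
      refine setLIntegral_mono' hZ.measurableSet.compl fun x hx => ?_
      rw [← ENNReal.ofReal_toReal (measure_ne_top (haarProb G) _)]
      exact ENNReal.ofReal_le_ofReal (h x hx)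
  have hne : haarProb G Z + ENNReal.ofReal c * haarProb G (Z : Set G)ᶜ ≠ ⊤ :=
    ENNReal.add_ne_top.2 ⟨measure_ne_top _ _, ENNReal.mul_ne_top ENNReal.ofReal_ne_top
      (measure_ne_top _ _)⟩
  refine (ENNReal.toReal_mono hne hle).trans_eq ?_
  rw [ENNReal.toReal_add (measure_ne_top _ _) (ENNReal.mul_ne_top ENNReal.ofReal_ne_top
      (measure_ne_top _ _)), ENNReal.toReal_mul, ENNReal.toReal_ofReal h0, mul_comm c]
  change (haarProb G).real Z + (haarProb G).real (Z : Set G)ᶜ * c = _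
  rw [probReal_compl_eq_one_sub hZ.measurableSet, haarProb_real_subgroup hZ]

lemma le_prod_real {E : Set (G × G)} (hE : MeasurableSet E) {Z : Subgroup G}
    (hZ : IsOpen (Z : Set G)) {c : ℝ} (h0 : 0 ≤ c) (h1 : ∀ x ∈ Z, ∀ y, (x, y) ∈ E)
    (h : ∀ x ∉ Z, c ≤ (haarProb G).real (Prod.mk x ⁻¹' E)) :
    (Z.index : ℝ)⁻¹ + (1 - (Z.index : ℝ)⁻¹) * c ≤
      ((haarProb G).prod (haarProb G)).real E := by
  have hle : haarProb G Z + ENNReal.ofReal c * haarProb G (Z : Set G)ᶜ ≤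
      ((haarProb G).prod (haarProb G)) E := by
    rw [Measure.prod_apply hE, ← lintegral_add_compl _ hZ.measurableSet]
    refine add_le_add ?_ ?_
    · calc haarProb G Z = ∫⁻ x in (Z : Set G), 1 ∂haarProb G := by simp
        _ ≤ _ := setLIntegral_mono' hZ.measurableSet fun x hx => by
          rw [show Prod.mk x ⁻¹' E = Set.univ from Set.eq_univ_of_forall (h1 x hx), measure_univ]
    · rw [← setLIntegral_const]
      refine setLIntegral_mono' hZ.measurableSet.compl fun x hx => ?_
      rw [← ENNReal.ofReal_toReal (measure_ne_top (haarProb G) (Prod.mk x ⁻¹' E))]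
      exact ENNReal.ofReal_le_ofReal (h x hx)
  refine Eq.trans_le ?_ (ENNReal.toReal_mono (measure_ne_top _ _) hle)
  rw [ENNReal.toReal_add (measure_ne_top _ _) (ENNReal.mul_ne_top ENNReal.ofReal_ne_top
      (measure_ne_top _ _)), ENNReal.toReal_mul, ENNReal.toReal_ofReal h0, mul_comm c]
  change _ = (haarProb G).real Z + (haarProb G).real (Z : Set G)ᶜ * c
  rw [probReal_compl_eq_one_sub hZ.measurableSet, haarProb_real_subgroup hZ]

/-- `perp x` depends only on the coset of `x` modulo `N`, so the set is a finite union of open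
rectangles. -/
lemma IsAltPairing.measurableSet_perp {Q : Type*} [Group Q] {f : G → G → Q}
    (hf : IsAltPairing f) {N : Subgroup G} [N.Normal] (hNo : IsOpen (N : Set G))
    (hN : ∀ x y, ∀ n ∈ N, ∀ m ∈ N, f (x * n) (y * m) = f x y) :
    MeasurableSet {q : G × G | q.2 ∈ hf.perp q.1} := by
  have : Finite (G ⧸ N) := N.quotient_finite_of_isOpen hNo
  have : DiscreteTopology (G ⧸ N) := QuotientGroup.discreteTopology hNo
  have heq : {q : G × G | q.2 ∈ hf.perp q.1} =
      ⋃ a : G ⧸ N, ((QuotientGroup.mk : G → G ⧸ N) ⁻¹' {a}) ×ˢ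
        ((hf.perp (Quotient.out a) : Subgroup G) : Set G) := by
    ext ⟨x, y⟩
    obtain ⟨n, hn⟩ := QuotientGroup.mk_out_eq_mul N x
    simp [hn, hf.perp_mul hN x n.2]
  rw [heq]
  refine MeasurableSet.iUnion fun a => MeasurableSet.prod ?_ ?_
  · exact ((isOpen_discrete {a}).preimage QuotientGroup.continuous_mk).measurableSet
  · exact (Subgroup.isOpen_mono (hf.le_perp hN _) hNo).measurableSet

/-- The upper bound for the exterior degree coming from an alternating pairing which factors
through a finite quotient. -/
lemma IsAltPairing.exteriorDegree_le [Fact p.Prime] {Q : Type*} [Group Q] {f : G → G → Q}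
    (hf : IsAltPairing f) {N : Subgroup G} (hNb : N ∈ openBasis p G)
    (hN : ∀ x y, ∀ n ∈ N, ∀ m ∈ N, f (x * n) (y * m) = f x y)
    (hw : ∀ x y : G, wedge p x y = 1 → f x y = 1) :
    exteriorDegree p G ≤
      (hf.radical.index : ℝ)⁻¹ + (1 - (hf.radical.index : ℝ)⁻¹) * (p : ℝ)⁻¹ := by
  have hNn : N.Normal := hNb.2.1
  have hNo := isOpen_of_mem_openBasis hNb
  have hp : 1 < p := (Fact.out : p.Prime).one_lt
  refine le_trans ?_ (prod_real_le (hf.measurableSet_perp hNo hN)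
    (Subgroup.isOpen_mono (hf.le_radical hN) hNo) (by positivity) fun x hx => ?_)
  -- The condition `x ∧ y = 1` is stable under simultaneous conjugation, hence puts `y` in `perp x`.
  · exact measureReal_mono fun q hq w => hw _ _ (wedge_conj hq w)
  · change (haarProb G).real (hf.perp x) ≤ _
    rw [haarProb_real_subgroup (Subgroup.isOpen_mono (hf.le_perp hN x) hNo)]
    obtain ⟨k, hk⟩ := index_eq_pow_of_le hNb (hf.le_perp hN x)
    have hk0 : k ≠ 0 := by
      rintro rfl
      exact hx (hf.perp_eq_top_iff.1 (Subgroup.index_eq_one.1 (by simpa using hk)))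
    rw [hk]
    gcongr
    exact Nat.le_self_pow hk0 p

/-- The upper bound for the exterior degree when the radical has index at least `n`. -/
lemma IsAltPairing.exteriorDegree_le_of_le_index [Fact p.Prime] {Q : Type*} [Group Q]
    {f : G → G → Q} (hf : IsAltPairing f) {N : Subgroup G} (hNb : N ∈ openBasis p G)
    (hN : ∀ x y, ∀ n ∈ N, ∀ m ∈ N, f (x * n) (y * m) = f x y)
    (hw : ∀ x y : G, wedge p x y = 1 → f x y = 1) {n : ℕ} (hn0 : 0 < n)
    (hn : n ≤ hf.radical.index) :
    exteriorDegree p G ≤ (n : ℝ)⁻¹ + (1 - (n : ℝ)⁻¹) * (p : ℝ)⁻¹ := by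
  refine (hf.exteriorDegree_le hNb hN hw).trans ?_
  have hp : (p : ℝ)⁻¹ ≤ 1 := inv_le_one_of_one_le₀ (by exact_mod_cast (Fact.out : p.Prime).one_le)
  have h : (hf.radical.index : ℝ)⁻¹ ≤ (n : ℝ)⁻¹ := by gcongr
  -- The bound is increasing in the inverse index because `p⁻¹ ≤ 1`.
  nlinarith [mul_nonneg (sub_nonneg.2 h) (sub_nonneg.2 hp)]

end Measure

/-! ### Refining a pairing, and the nonabelian case -/

section Refine

variable {p : ℕ} [Fact p.Prime] {G : Type*} [Group G] [TopologicalSpace G]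

/-- Both indices are powers of `p`, so a proper inclusion raises the exponent by at least one. -/
lemma pow_succ_le_index {N H K : Subgroup G} (hN : N ∈ openBasis p G) (hNH : N ≤ H) (h : H < K)
    {k : ℕ} (hk : p ^ k ≤ K.index) : p ^ (k + 1) ≤ H.index := by
  have hp : 1 < p := (Fact.out : p.Prime).one_lt
  obtain ⟨a, ha⟩ := index_eq_pow_of_le hN (hNH.trans h.le)
  obtain ⟨b, hb⟩ := index_eq_pow_of_le hN hNH
  have : H.FiniteIndex := ⟨by rw [hb]; positivity⟩
  have hlt := Subgroup.index_strictAnti h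
  rw [ha, hb, Nat.pow_lt_pow_iff_right hp] at hlt
  rw [ha, Nat.pow_le_pow_iff_right hp] at hk
  rw [hb]
  exact Nat.pow_le_pow_right hp.le (by omega)

variable [IsTopologicalGroup G] [CompactSpace G]

lemma wedge_commutator {N : Subgroup G} (hNb : N ∈ openBasis p G) {x y : G}
    (h : wedge p x y = 1) : x⁻¹ * y⁻¹ * x * y ∈ N := by
  have hNn : N.Normal := hNb.2.1
  have hNo := isOpen_of_mem_openBasis hNb
  have : Finite (G ⧸ N) := N.quotient_finite_of_isOpen hNo
  have : DiscreteTopology (G ⧸ N) := QuotientGroup.discreteTopology hNo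
  refine (QuotientGroup.eq_one_iff _).1
    ((IsAltPairing.commutator N).eq_one_of_wedge (IsPGroup.iff_card.2 hNb.2.2) ?_ h)
  rw [IsLocallyConstant.iff_continuous]
  exact QuotientGroup.continuous_mk.comp (by fun_prop)

/-- The radical is the preimage of the center of `G ⧸ N`. An index dividing `p` would make the
central quotient cyclic and `G ⧸ N` commutative. -/
lemma pow_two_le_index_radical_commutator {N : Subgroup G} [N.Normal] (hNb : N ∈ openBasis p G)
    {a b : G} (hab : a⁻¹ * b⁻¹ * a * b ∉ N) :
    p ^ 2 ≤ (IsAltPairing.commutator N).radical.index := by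
  have heq : (IsAltPairing.commutator N).radical =
      (Subgroup.center (G ⧸ N)).comap (QuotientGroup.mk' N) := by
    ext x
    rw [Subgroup.mem_comap, Subgroup.mem_center_iff, IsAltPairing.mem_radical]
    constructor
    · intro h y
      obtain ⟨y, rfl⟩ := QuotientGroup.mk_surjective y
      have h1 := h y 1
      rw [show (1⁻¹ * x * 1)⁻¹ * y⁻¹ * (1⁻¹ * x * 1) * y = (y * x)⁻¹ * (x * y) by group] at h1
      exact QuotientGroup.eq.2 ((QuotientGroup.eq_one_iff _).1 h1)
    · intro h y w
      have h1 : ∀ y, (QuotientGroup.mk y * QuotientGroup.mk x : G ⧸ N) =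
        QuotientGroup.mk x * QuotientGroup.mk y := fun y => h y
      have h2 : (QuotientGroup.mk (w⁻¹ * x * w) : G ⧸ N) = QuotientGroup.mk x := by
        rw [QuotientGroup.mk_mul, QuotientGroup.mk_mul, h1, mul_assoc, ← QuotientGroup.mk_mul,
          inv_mul_cancel, QuotientGroup.mk_one, mul_one]
      simp only [QuotientGroup.mk_mul, QuotientGroup.mk_inv] at h1 h2 ⊢
      rw [h2, mul_assoc, ← h1]
      group
  rw [heq, Subgroup.index_comap_of_surjective _ (QuotientGroup.mk'_surjective N)]
  have : Finite (G ⧸ N) := N.quotient_finite_of_isOpen (isOpen_of_mem_openBasis hNb)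
  have hp : 1 < p := (Fact.out : p.Prime).one_lt
  obtain ⟨k, hk⟩ := (IsPGroup.iff_card.2 hNb.2.2 : IsPGroup p (G ⧸ N)).index
    (Subgroup.center (G ⧸ N))
  rw [hk]
  refine Nat.pow_le_pow_right hp.le ?_
  by_contra! hlt
  have hcyc : IsCyclic ((G ⧸ N) ⧸ Subgroup.center (G ⧸ N)) :=
    isCyclic_of_card_dvd_prime (p := p) (by
      change (Subgroup.center (G ⧸ N)).index ∣ p
      rw [hk]
      exact (pow_dvd_pow p (by omega : k ≤ 1)).trans (pow_one p).dvd)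
  have hcomm := (isMulCommutative_of_isCyclic_quotient_center_self (G ⧸ N)).is_comm.comm
    (QuotientGroup.mk a) (QuotientGroup.mk b)
  apply hab
  rw [show a⁻¹ * b⁻¹ * a * b = (b * a)⁻¹ * (a * b) by group]
  exact QuotientGroup.eq.1 hcomm.symm

variable [T2Space G]

/-- If `x ∧ y = 1`, the commutator of `x` and `y` lies in every member of `openBasis`, hence is
trivial. -/
lemma exteriorCenter_le_center (hG : IsProP p G) : exteriorCenter p G ≤ Subgroup.center G := by
  intro x hx
  rw [Subgroup.mem_center_iff]
  intro y
  have := hG.eq_one fun N hN => wedge_commutator hN (hx y)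
  have h2 : x⁻¹ * y⁻¹ * x * y = (y * x)⁻¹ * (x * y) := by group
  rwa [h2, inv_mul_eq_one] at this

variable [MeasurableSpace G] [BorelSpace G]

/-- If the radical of a pairing contains an element outside the exterior center, then the pairing
may be refined to one whose radical is smaller, which improves the bound for the exterior degree. -/
lemma IsAltPairing.exteriorDegree_le_of_wedge_ne_one (hG : IsProP p G) {R : Type*} [Group R]
    {g : G → G → R} (hg : IsAltPairing g) {N : Subgroup G} (hNb : N ∈ openBasis p G)
    (hN : ∀ x y, ∀ n ∈ N, ∀ m ∈ N, g (x * n) (y * m) = g x y)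
    (hw : ∀ x y : G, wedge p x y = 1 → g x y = 1) {k : ℕ} (hk : p ^ k ≤ hg.radical.index)
    {z y : G} (hz : z ∈ hg.radical) (hzy : wedge p z y ≠ 1) :
    exteriorDegree p G ≤
      ((p : ℝ) ^ (k + 1))⁻¹ + (1 - ((p : ℝ) ^ (k + 1))⁻¹) * (p : ℝ)⁻¹ := by
  obtain ⟨W, hW, f, hfin, hp, hf, hc, hfne⟩ := exists_isAltPairing_ne_one hzy
  obtain ⟨M, hMb, hM⟩ := hG.exists_invariant hc
  -- The radical of the product pairing lies in that of `g` and omits `z`, since `f z y ≠ 1`.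
  have hfg := hf.prod hg
  have hinf := inf_mem_openBasis hNb hMb
  have hinv : ∀ x y, ∀ n ∈ N ⊓ M, ∀ m ∈ N ⊓ M,
      (f (x * n) (y * m), g (x * n) (y * m)) = (f x y, g x y) := fun x y n hn m hm => by
    rw [hM x y n hn.2 m hm.2, hN x y n hn.1 m hm.1]
  have hn := hinf.2.1
  have hlt : hfg.radical < hg.radical := by
    refine lt_of_le_of_ne (fun x hx y w => congrArg Prod.snd (hx y w)) fun h => hfne ?_
    rw [← h] at hz
    simpa using congrArg Prod.fst (hz y 1)
  have := hfg.exteriorDegree_le_of_le_index hinf hinv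
    (fun x y h => Prod.ext (hf.eq_one_of_wedge hp hc h) (hw x y h))
    (pow_pos (Fact.out : p.Prime).pos (k + 1))
    (pow_succ_le_index hinf (hfg.le_radical hinv) hlt hk)
  simpa using this

/-- The bound for nonabelian groups whose exterior center differs from the center. -/
theorem exteriorDegree_le_of_not_comm (hG : IsProP p G) (hne : ¬ ∀ a b : G, a * b = b * a)
    (hZ : exteriorCenter p G ≠ Subgroup.center G) :
    exteriorDegree p G ≤ ((p : ℝ) ^ 3)⁻¹ + (1 - ((p : ℝ) ^ 3)⁻¹) * (p : ℝ)⁻¹ := by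
  push Not at hne
  obtain ⟨a, b, hab⟩ := hne
  obtain ⟨N, hNb, hN⟩ : ∃ N ∈ openBasis p G, a⁻¹ * b⁻¹ * a * b ∉ N := by
    by_contra! h
    have := hG.eq_one h
    rw [show a⁻¹ * b⁻¹ * a * b = (b * a)⁻¹ * (a * b) by group, inv_mul_eq_one] at this
    exact hab this.symm
  have hNn : N.Normal := hNb.2.1
  obtain ⟨z, hz, hze⟩ := SetLike.exists_of_lt (lt_of_le_of_ne (exteriorCenter_le_center hG) hZ)
  obtain ⟨y, hy⟩ : ∃ y : G, wedge p z y ≠ 1 := by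
    by_contra! h
    exact hze h
  refine (IsAltPairing.commutator N).exteriorDegree_le_of_wedge_ne_one hG hNb ?_
    (fun x y h => (QuotientGroup.eq_one_iff _).2 (wedge_commutator hNb h))
    (pow_two_le_index_radical_commutator hNb hN) (z := z) (y := y) ?_ hy
  · intro x y n hn m hm
    have h1 : (QuotientGroup.mk (x * n) : G ⧸ N) = QuotientGroup.mk x :=
      QuotientGroup.mk_mul_of_mem x hn
    have h2 : (QuotientGroup.mk (y * m) : G ⧸ N) = QuotientGroup.mk y :=
      QuotientGroup.mk_mul_of_mem y hm
    change (QuotientGroup.mk (x * n) : G ⧸ N)⁻¹ * (QuotientGroup.mk (y * m))⁻¹ *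
      QuotientGroup.mk (x * n) * QuotientGroup.mk (y * m) = _
    rw [h1, h2]
    rfl
  · intro y w
    have hc := Subgroup.mem_center_iff.1 hz
    rw [show w⁻¹ * z * w = z by rw [mul_assoc, ← hc w, inv_mul_cancel_left]]
    refine (QuotientGroup.eq_one_iff _).2 ?_
    rw [mul_assoc, ← hc y, mul_assoc, inv_mul_cancel_left, inv_mul_cancel]
    exact N.one_mem

end Refine

/-! ### Noncyclic abelian `p`-groups -/

lemma exists_generator_or_surjective {K : Type*} [Field K] (V : Type*) [AddCommGroup V] [Module K V]
    [Finite V] :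
    (∃ v : V, ∀ w : V, ∃ c : K, c • v = w) ∨ ∃ ψ : V →+ (Fin 2 → K), Function.Surjective ψ := by
  have : Module.Finite K V := Module.Finite.of_finite
  by_cases hr : Module.finrank K V ≤ 1
  · exact Or.inl (finrank_le_one_iff.1 hr)
  · have hle : 2 ≤ Module.finrank K V := by omega
    let b := Module.finBasis K V
    exact Or.inr ⟨((LinearMap.funLeft K K (Fin.castLE hle)).comp
      b.equivFun.toLinearMap).toAddMonoidHom,
      (LinearMap.funLeft_surjective_of_injective K K _
        (Fin.castLE_injective hle)).comp b.equivFun.surjective⟩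

/-- The abelian Burnside basis argument. If one element `a` generates `A` modulo `p`-th powers,
iteration gives `A = ⟨a⟩ A ^ (p ^ k)` for all `k`; taking `p ^ k = |A|` makes `A` cyclic. Otherwise
`A / A ^ p` has dimension at least two over `ZMod p`. -/
lemma exists_surjective_of_not_isCyclic {p : ℕ} [Fact p.Prime] {A : Type*} [CommGroup A] [Finite A]
    (hA : IsPGroup p A) (hc : ¬ IsCyclic A) :
    ∃ φ : A →* Multiplicative (ZMod p) × Multiplicative (ZMod p), Function.Surjective φ := by
  set P : Subgroup A := (powMonoidHom p : A →* A).range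
  let : Module (ZMod p) (Additive (A ⧸ P)) := AddCommGroup.zmodModule (n := p) (by
    intro x
    obtain ⟨a, ha⟩ := QuotientGroup.mk_surjective x.toMul
    have : x.toMul ^ p = 1 := by
      rw [← ha, ← QuotientGroup.mk_pow]
      exact (QuotientGroup.eq_one_iff _).2 ⟨a, rfl⟩
    exact congrArg Additive.ofMul this)
  obtain ⟨v, hv⟩ | ⟨ψ, hψ⟩ := exists_generator_or_surjective (K := ZMod p) (Additive (A ⧸ P))
  · exfalso
    obtain ⟨a, ha⟩ := QuotientGroup.mk_surjective v.toMul
    have h1 : ∀ x : A, ∃ (m : ℕ) (y : A), x = a ^ m * y ^ p := by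
      intro x
      obtain ⟨c, hc⟩ := hv (Additive.ofMul (QuotientGroup.mk x))
      obtain ⟨m, rfl⟩ := ZMod.natCast_zmod_surjective c
      rw [Nat.cast_smul_eq_nsmul] at hc
      have hc' : (QuotientGroup.mk (a ^ m) : A ⧸ P) = QuotientGroup.mk x := by
        rw [QuotientGroup.mk_pow, ha]
        exact congrArg Additive.toMul hc
      obtain ⟨y, hy⟩ := QuotientGroup.eq.1 hc'
      refine ⟨m, y, ?_⟩
      rw [show y ^ p = (a ^ m)⁻¹ * x from hy, mul_inv_cancel_left]
    have h2 : ∀ (k : ℕ) (x : A), ∃ (m : ℕ) (y : A), x = a ^ m * y ^ p ^ k := by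
      intro k
      induction k with
      | zero => exact fun x => ⟨0, x, by simp⟩
      | succ k ih =>
        intro x
        obtain ⟨m, y, rfl⟩ := ih x
        obtain ⟨l, u, rfl⟩ := h1 y
        refine ⟨m + l * p ^ k, u, ?_⟩
        rw [mul_pow, ← pow_mul, ← pow_mul, ← mul_assoc, ← pow_add, pow_succ' p]
    obtain ⟨k, hk⟩ := IsPGroup.iff_card.1 hA
    refine hc ⟨a, fun x => ?_⟩
    obtain ⟨m, y, rfl⟩ := h2 k x
    rw [← hk, pow_card_eq_one', mul_one]
    exact ⟨m, zpow_natCast a m⟩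
  · let φ : A →* Multiplicative (ZMod p) × Multiplicative (ZMod p) :=
      { toFun := fun a => (Multiplicative.ofAdd (ψ (Additive.ofMul (QuotientGroup.mk a)) 0),
          Multiplicative.ofAdd (ψ (Additive.ofMul (QuotientGroup.mk a)) 1))
        map_one' := by simp
        map_mul' := fun x y => by simp }
    refine ⟨φ, fun q => ?_⟩
    obtain ⟨v, hv⟩ := hψ ![q.1.toAdd, q.2.toAdd]
    obtain ⟨a, ha⟩ := QuotientGroup.mk_surjective v.toMul
    refine ⟨a, ?_⟩
    have : ψ (Additive.ofMul (QuotientGroup.mk a)) = ![q.1.toAdd, q.2.toAdd] := by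
      rw [ha]; exact hv
    simp [φ, this]

/-! ### From rank to a surjection onto `C_p × C_p` -/

section Rank

variable {p : ℕ} [Fact p.Prime] {G : Type*} [Group G] [TopologicalSpace G] [IsTopologicalGroup G]
  [CompactSpace G] [T2Space G]

/-- If all the finite quotients of a pro-`p` group are cyclic, then so are its closed subgroups,
topologically. -/
lemma exists_topologicalClosure_eq (hG : IsProP p G)
    (hcyc : ∀ N ∈ openBasis p G, ∃ _ : N.Normal, IsCyclic (G ⧸ N)) (H : ClosedSubgroup G) :
    ∃ h : G, (Subgroup.closure {h}).topologicalClosure = H.toSubgroup := by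
  have hHc : IsClosed (H.toSubgroup : Set G) := H.isClosed'
  -- `S N` consists of the elements of `H` whose image generates the image of `H` in `G ⧸ N`. These
  -- sets are closed, directed and nonempty, so by compactness they share an element `h`.
  let S : openBasis p G → Set G := fun N =>
    {h | h ∈ H.toSubgroup ∧ ∀ x ∈ H.toSubgroup, ∃ k : ℤ, (h ^ k)⁻¹ * x ∈ (N : Subgroup G)}
  have : Nonempty (openBasis p G) := ⟨⟨⊤, top_mem_openBasis⟩⟩
  have hclosed : ∀ N, IsClosed (S N) := by
    intro N
    have hNo := isOpen_of_mem_openBasis N.2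
    have hNn : (N : Subgroup G).Normal := N.2.2.1
    have : DiscreteTopology (G ⧸ (N : Subgroup G)) := QuotientGroup.discreteTopology hNo
    have heq : S N = (H.toSubgroup : Set G) ∩
        (QuotientGroup.mk : G → G ⧸ (N : Subgroup G)) ⁻¹'
          {q | ∀ x ∈ H.toSubgroup, ∃ k : ℤ, q ^ k = QuotientGroup.mk x} := by
      ext h
      refine and_congr_right fun _ => forall₂_congr fun x _ => exists_congr fun k => ?_
      rw [← QuotientGroup.mk_zpow, QuotientGroup.eq]
    rw [heq]
    exact hHc.inter ((isClosed_discrete _).preimage QuotientGroup.continuous_mk)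
  obtain ⟨h, hh⟩ := IsCompact.nonempty_iInter_of_directed_nonempty_isCompact_isClosed S
    (fun N M => ⟨⟨_, inf_mem_openBasis N.2 M.2⟩,
      fun h hh => ⟨hh.1, fun x hx => (hh.2 x hx).imp fun k hk => hk.1⟩,
      fun h hh => ⟨hh.1, fun x hx => (hh.2 x hx).imp fun k hk => hk.2⟩⟩)
    (fun N => by
      obtain ⟨hNn, hN⟩ := hcyc N N.2
      obtain ⟨g, hg⟩ := (inferInstance :
        IsCyclic (H.toSubgroup.map (QuotientGroup.mk' (N : Subgroup G)))).exists_generator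
      obtain ⟨h, hH, hhg⟩ := g.2
      refine ⟨h, hH, fun x hx => ?_⟩
      obtain ⟨k, hk⟩ := hg ⟨QuotientGroup.mk' _ x, x, hx, rfl⟩
      refine ⟨k, QuotientGroup.eq.1 ?_⟩
      have := congrArg Subtype.val hk
      simpa [← hhg] using this)
    (fun N => (hclosed N).isCompact) hclosed
  rw [Set.mem_iInter] at hh
  refine ⟨h, le_antisymm (Subgroup.topologicalClosure_minimal _ ?_ hHc) fun x hx => ?_⟩
  · rw [Subgroup.closure_le, Set.singleton_subset_iff]
    exact (hh ⟨⊤, top_mem_openBasis⟩).1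
  · change x ∈ closure _
    rw [mem_closure_iff_nhds]
    intro U hU
    -- The map is chosen to send `(h ^ k)⁻¹ * x` to `h ^ k`.
    have hU' : (fun g : G => x * g⁻¹) ⁻¹' U ∈ 𝓝 (1 : G) :=
      ContinuousAt.preimage_mem_nhds (by fun_prop) (by simpa using hU)
    obtain ⟨N, hN, hNU⟩ := hG.exists_le_nhds hU'
    obtain ⟨k, hk⟩ := (hh ⟨N, hN⟩).2 x hx
    refine ⟨h ^ k, ?_, (Subgroup.closure {h}).zpow_mem (Subgroup.mem_closure_singleton_self h) k⟩
    have := hNU hk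
    simpa using this

/-- A commutative pro-`p` group of rank greater than one maps onto `C_p × C_p`. -/
lemma exists_surjective_of_one_lt_rank (hG : IsProP p G) (hcomm : ∀ a b : G, a * b = b * a)
    (hr : 1 < rank G) :
    ∃ N ∈ openBasis p G, ∃ φ : G →* Multiplicative (ZMod p) × Multiplicative (ZMod p),
      Function.Surjective φ ∧ N ≤ φ.ker := by
  obtain ⟨N, hNb, hN⟩ : ∃ N ∈ openBasis p G, ∀ _ : N.Normal, ¬ IsCyclic (G ⧸ N) := by
    by_contra! hcyc
    obtain ⟨H, hH⟩ := lt_iSup_iff.1 hr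
    obtain ⟨h, hh⟩ := exists_topologicalClosure_eq hG hcyc H
    refine hH.not_ge ((iInf₂_le {h} hh).trans ?_)
    rw [Set.encard_singleton]
  have hNn : N.Normal := hNb.2.1
  let : CommGroup (G ⧸ N) :=
    { (inferInstance : Group (G ⧸ N)) with
      mul_comm := by
        intro a b
        obtain ⟨a, rfl⟩ := QuotientGroup.mk_surjective a
        obtain ⟨b, rfl⟩ := QuotientGroup.mk_surjective b
        exact congrArg QuotientGroup.mk (hcomm a b) }
  have : Finite (G ⧸ N) := N.quotient_finite_of_isOpen (isOpen_of_mem_openBasis hNb)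
  obtain ⟨φ, hφ⟩ := exists_surjective_of_not_isCyclic (IsPGroup.iff_card.2 hNb.2.2) (hN hNn)
  refine ⟨N, hNb, φ.comp (QuotientGroup.mk' N), hφ.comp (QuotientGroup.mk'_surjective N),
    fun n hn => ?_⟩
  rw [MonoidHom.mem_ker, MonoidHom.comp_apply, QuotientGroup.mk'_apply,
    (QuotientGroup.eq_one_iff n).2 hn, map_one]

end Rank

/-! ### The determinant pairing and the abelian case -/

section Det

variable {p : ℕ} [Fact p.Prime] {G : Type*} [Group G]

/-- The determinant pairing attached to a homomorphism to `C_p × C_p`. -/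
def detPairing (φ : G →* Multiplicative (ZMod p) × Multiplicative (ZMod p)) (x y : G) :
    Multiplicative (ZMod p) :=
  Multiplicative.ofAdd ((φ x).1.toAdd * (φ y).2.toAdd - (φ x).2.toAdd * (φ y).1.toAdd)

variable (φ : G →* Multiplicative (ZMod p) × Multiplicative (ZMod p))

lemma map_conj_eq (x w : G) : φ (w⁻¹ * x * w) = φ x := by
  rw [map_mul, map_mul, map_inv, mul_comm, mul_inv_cancel_left]

lemma isAltPairing_detPairing : IsAltPairing (detPairing φ) where
  mul_left x y z := by
    simp only [detPairing, map_conj_eq]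
    simp only [map_mul, Prod.fst_mul, Prod.snd_mul, toAdd_mul,
      ← ofAdd_add]
    congr 1
    ring
  mul_right x y z := by
    simp only [detPairing, map_conj_eq]
    simp only [map_mul, Prod.fst_mul, Prod.snd_mul, toAdd_mul,
      ← ofAdd_add]
    congr 1
    ring
  self x := by
    rw [detPairing, mul_comm, sub_self, ofAdd_zero]

/-- Pairing with preimages of the two basis vectors recovers the coordinates of `φ x` up to sign. -/
lemma radical_detPairing (hφ : Function.Surjective φ) :
    (isAltPairing_detPairing φ).radical = φ.ker := by
  ext x
  rw [IsAltPairing.mem_radical, MonoidHom.mem_ker]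
  constructor
  · intro h
    obtain ⟨a, ha⟩ := hφ (Multiplicative.ofAdd 1, 1)
    obtain ⟨b, hb⟩ := hφ (1, Multiplicative.ofAdd 1)
    have h1 := h a 1
    have h2 := h b 1
    simp only [detPairing, map_conj_eq] at h1 h2
    simp only [ha, hb, toAdd_one, toAdd_ofAdd, mul_zero, mul_one,
      zero_sub, sub_zero, ofAdd_neg, inv_eq_one, ofAdd_toAdd] at h1 h2
    exact Prod.ext h2 h1
  · intro h y w
    simp [detPairing, map_conj_eq, h]

lemma detPairing_mul_mul {x y n m : G} (hn : n ∈ φ.ker) (hm : m ∈ φ.ker) :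
    detPairing φ (x * n) (y * m) = detPairing φ x y := by
  simp only [detPairing, map_mul, MonoidHom.mem_ker.1 hn, MonoidHom.mem_ker.1 hm, mul_one]

lemma index_ker_eq_sq (hφ : Function.Surjective φ) : φ.ker.index = p ^ 2 := by
  rw [Subgroup.index_ker, MonoidHom.range_eq_top.2 hφ, Subgroup.card_top, Nat.card_prod,
    show Nat.card (Multiplicative (ZMod p)) = p from Nat.card_zmod p, sq]

/-- `detPairing φ x` is a homomorphism to `ZMod p` whose kernel lies in `perp x`. This feeds the
lower bound in the equality case. -/
lemma index_perp_detPairing_le (x : G) : ((isAltPairing_detPairing φ).perp x).index ≤ p := by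
  let χ : G →* Multiplicative (ZMod p) :=
    { toFun := detPairing φ x
      map_one' := (isAltPairing_detPairing φ).one_right x
      map_mul' := fun y z => by
        simp only [detPairing, map_mul, Prod.fst_mul, Prod.snd_mul, toAdd_mul, ← ofAdd_add]
        congr 1
        ring }
  have hle : χ.ker ≤ (isAltPairing_detPairing φ).perp x := fun y hy w => by
    have : detPairing φ x y = 1 := hy
    simpa [detPairing, map_conj_eq] using this
  have hcard : χ.ker.index ≤ p := by
    rw [Subgroup.index_ker]
    exact (Nat.card_le_card_of_injective _ Subtype.val_injective).trans_eq (Nat.card_zmod p)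
  have h0 : χ.ker.index ≠ 0 := by
    rw [Subgroup.index_ker]
    exact Nat.card_pos.ne'
  exact (Nat.le_of_dvd (Nat.pos_of_ne_zero h0) (Subgroup.index_dvd_of_le hle)).trans hcard

/-- Vectors with vanishing determinant are proportional. -/
lemma exists_pow_of_detPairing_eq_one {x y : G} (hx : φ x ≠ 1) (h : detPairing φ x y = 1) :
    ∃ k : ℕ, φ y = φ x ^ k := by
  have hd : (φ x).1.toAdd * (φ y).2.toAdd = (φ x).2.toAdd * (φ y).1.toAdd :=
    sub_eq_zero.1 (congrArg Multiplicative.toAdd h)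
  have key : ∃ c : ZMod p, (φ y).1.toAdd = c * (φ x).1.toAdd ∧
      (φ y).2.toAdd = c * (φ x).2.toAdd := by
    by_cases h1 : (φ x).1.toAdd = 0
    · have h2 : (φ x).2.toAdd ≠ 0 := fun h2 => hx (Prod.ext h1 h2)
      refine ⟨(φ y).2.toAdd / (φ x).2.toAdd, ?_, by field_simp⟩
      rw [h1, zero_mul, eq_comm, mul_eq_zero] at hd
      rw [h1, mul_zero]
      exact hd.resolve_left h2
    · refine ⟨(φ y).1.toAdd / (φ x).1.toAdd, by field_simp, ?_⟩
      field_simp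
      linear_combination hd
  obtain ⟨c, hc1, hc2⟩ := key
  obtain ⟨k, rfl⟩ := ZMod.natCast_zmod_surjective c
  rw [← nsmul_eq_mul] at hc1 hc2
  exact ⟨k, Prod.ext hc1 hc2⟩

end Det

lemma conj_eq_self_of_comm {G : Type*} [Group G] (hcomm : ∀ a b : G, a * b = b * a) (x w : G) :
    w⁻¹ * x * w = x := by
  rw [mul_assoc, hcomm x, inv_mul_cancel_left]

/-! ### The exterior square of an abelian group and the determinant -/

section Abelian

variable {p : ℕ} {G : Type*} [Group G] [TopologicalSpace G]

lemma wedge_self (x : G) : wedge p x x = 1 :=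
  (QuotientGroup.eq_one_iff _).2
    (Subgroup.le_topologicalClosure _ (Subgroup.subset_closure ⟨x, rfl⟩))

lemma wedge_one_right (x : G) : wedge p x 1 = 1 := by
  simpa using wedge_mul_right (p := p) x 1 1

section Comm

variable (hcomm : ∀ a b : G, a * b = b * a)

include hcomm

lemma wedge_pow_right_of_comm (x : G) (k : ℕ) : wedge p x (x ^ k) = 1 := by
  induction k with
  | zero => rw [pow_zero, wedge_one_right]
  | succ k ih =>
    rw [pow_succ, wedge_mul_right, conj_eq_self_of_comm hcomm, conj_eq_self_of_comm hcomm, ih,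
      wedge_self, one_mul]

/-- Expand `(x * z) ∧ (x * z) = 1`: all factors but `x ∧ z` are trivial. -/
lemma wedge_right_of_mem_exteriorCenter (x : G) {z : G} (hz : z ∈ exteriorCenter p G) :
    wedge p x z = 1 := by
  have h := wedge_self (p := p) (x * z)
  rw [wedge_mul_left, conj_eq_self_of_comm hcomm, conj_eq_self_of_comm hcomm, hz, mul_one,
    wedge_mul_right, conj_eq_self_of_comm hcomm, wedge_self, mul_one] at h
  exact h

variable [Fact p.Prime] (φ : G →* Multiplicative (ZMod p) × Multiplicative (ZMod p))

/-- If the exterior center is the kernel of `φ`, then the exterior square is detected by the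
determinant. -/
lemma wedge_eq_one_of_detPairing (h : exteriorCenter p G = φ.ker) {x y : G}
    (hxy : detPairing φ x y = 1) : wedge p x y = 1 := by
  by_cases hx : φ x = 1
  · have : x ∈ exteriorCenter p G := h ▸ hx
    exact this y
  · obtain ⟨k, hk⟩ := exists_pow_of_detPairing_eq_one φ hx hxy
    -- So `y` is a power of `x` times an element of the exterior center, and both factors are
    -- orthogonal to `x`.
    have hz : (x ^ k)⁻¹ * y ∈ exteriorCenter p G := by
      rw [h, MonoidHom.mem_ker, map_mul, map_inv, map_pow, hk, inv_mul_cancel]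
    have := wedge_mul_right (p := p) x (x ^ k) ((x ^ k)⁻¹ * y)
    rwa [mul_inv_cancel_left, conj_eq_self_of_comm hcomm, conj_eq_self_of_comm hcomm,
      wedge_pow_right_of_comm hcomm, mul_one, wedge_right_of_mem_exteriorCenter hcomm x hz] at this

end Comm

variable [Fact p.Prime] [IsTopologicalGroup G]
  {φ : G →* Multiplicative (ZMod p) × Multiplicative (ZMod p)}

lemma detPairing_eq_one_of_wedge {N : Subgroup G} (hNb : N ∈ openBasis p G) (hNφ : N ≤ φ.ker)
    {x y : G} (h : wedge p x y = 1) : detPairing φ x y = 1 := by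
  have hp : IsPGroup p (Multiplicative (ZMod p)) :=
    IsPGroup.of_card (n := 1) ((Nat.card_zmod p).trans (pow_one p).symm)
  refine (isAltPairing_detPairing φ).eq_one_of_wedge hp ?_ h
  have hφ : IsLocallyConstant φ := by
    have hker := Subgroup.isOpen_mono hNφ (isOpen_of_mem_openBasis hNb)
    rw [IsLocallyConstant.iff_eventually_eq]
    intro x
    filter_upwards [(hker.preimage (f := fun y => x⁻¹ * y) (by fun_prop)).mem_nhds
      (x := x) (by simp)] with y hy
    have : φ (x⁻¹ * y) = 1 := hy
    rw [map_mul, map_inv, inv_mul_eq_one] at this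
    exact this.symm
  exact ((hφ.comp_continuous continuous_fst).prodMk (hφ.comp_continuous continuous_snd)).comp
    fun q : (Multiplicative (ZMod p) × Multiplicative (ZMod p)) ×
      (Multiplicative (ZMod p) × Multiplicative (ZMod p)) =>
    Multiplicative.ofAdd (q.1.1.toAdd * q.2.2.toAdd - q.1.2.toAdd * q.2.1.toAdd)

lemma exteriorCenter_le_ker {N : Subgroup G} (hNb : N ∈ openBasis p G) (hNφ : N ≤ φ.ker)
    (hφ : Function.Surjective φ) : exteriorCenter p G ≤ φ.ker := by
  intro x hx
  rw [← radical_detPairing φ hφ]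
  intro y w
  have := detPairing_eq_one_of_wedge hNb hNφ (hx y)
  simpa [detPairing, map_conj_eq] using this

/-- An abstract isomorphism suffices: the exterior center always lies in `φ.ker`, and then both have
index `p ^ 2`. -/
lemma eq_ker_iff_nonempty_mulEquiv {N : Subgroup G} (hNb : N ∈ openBasis p G) (hNφ : N ≤ φ.ker)
    (hφ : Function.Surjective φ) :
    exteriorCenter p G = φ.ker ↔ Nonempty (G ⧸ exteriorCenter p G ≃*
      Multiplicative (ZMod p) × Multiplicative (ZMod p)) := by
  refine ⟨fun h => ⟨(QuotientGroup.quotientMulEquivOfEq h).trans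
    (QuotientGroup.quotientKerEquivOfSurjective φ hφ)⟩, fun ⟨e⟩ => ?_⟩
  have hle := exteriorCenter_le_ker hNb hNφ hφ
  have hi : (exteriorCenter p G).index = p ^ 2 := by
    rw [Subgroup.index, Nat.card_congr e.toEquiv, Nat.card_prod,
      show Nat.card (Multiplicative (ZMod p)) = p from Nat.card_zmod p, sq]
  have hr := Subgroup.relIndex_mul_index hle
  rw [hi, index_ker_eq_sq φ hφ] at hr
  exact le_antisymm hle (Subgroup.relIndex_eq_one.1
    (Nat.eq_of_mul_eq_mul_right (pow_pos (Fact.out : p.Prime).pos 2) (hr.trans (one_mul _).symm)))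

variable [CompactSpace G] [MeasurableSpace G] [BorelSpace G]

lemma exteriorDegree_le_of_surjective {N : Subgroup G} (hNb : N ∈ openBasis p G)
    (hNφ : N ≤ φ.ker) (hφ : Function.Surjective φ) :
    exteriorDegree p G ≤ ((p : ℝ) ^ 2)⁻¹ + (1 - ((p : ℝ) ^ 2)⁻¹) * (p : ℝ)⁻¹ := by
  have := (isAltPairing_detPairing φ).exteriorDegree_le_of_le_index hNb
    (fun x y n hn m hm => detPairing_mul_mul φ (hNφ hn) (hNφ hm))
    (fun x y h => detPairing_eq_one_of_wedge hNb hNφ h) (n := p ^ 2)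
    (pow_pos (Fact.out : p.Prime).pos 2)
    (by rw [radical_detPairing φ hφ, index_ker_eq_sq φ hφ])
  simpa using this

/-- Here a trivial determinant forces a trivial symbol, so the orthogonal subgroups of the
determinant, of index at most `p`, bound the degree from below. -/
lemma le_exteriorDegree_of_eq_ker (hcomm : ∀ a b : G, a * b = b * a) {N : Subgroup G}
    (hNb : N ∈ openBasis p G) (hNφ : N ≤ φ.ker) (hφ : Function.Surjective φ)
    (h : exteriorCenter p G = φ.ker) :
    ((p : ℝ) ^ 2)⁻¹ + (1 - ((p : ℝ) ^ 2)⁻¹) * (p : ℝ)⁻¹ ≤ exteriorDegree p G := by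
  have hf := isAltPairing_detPairing φ
  have hNn : N.Normal := hNb.2.1
  have hNo := isOpen_of_mem_openBasis hNb
  have hinv : ∀ x y, ∀ n ∈ N, ∀ m ∈ N, detPairing φ (x * n) (y * m) = detPairing φ x y :=
    fun x y n hn m hm => detPairing_mul_mul φ (hNφ hn) (hNφ hm)
  have key := le_prod_real (hf.measurableSet_perp hNo hinv)
    (Subgroup.isOpen_mono hNφ hNo) (c := (p : ℝ)⁻¹) (by positivity)
    (fun x hx y => (Subgroup.eq_top_iff' _).1
      (hf.perp_eq_top_iff.2 (by rwa [radical_detPairing φ hφ])) y)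
    (fun x _ => by
      change _ ≤ (haarProb G).real (hf.perp x)
      have ho := Subgroup.isOpen_mono (hf.le_perp hinv x) hNo
      rw [haarProb_real_subgroup ho]
      have : Finite (G ⧸ hf.perp x) := Subgroup.quotient_finite_of_isOpen _ ho
      have h0 : (0 : ℝ) < (hf.perp x).index := by
        exact_mod_cast Nat.card_pos (α := G ⧸ hf.perp x)
      exact inv_anti₀ h0 (by exact_mod_cast index_perp_detPairing_le φ x))
  rw [index_ker_eq_sq φ hφ, Nat.cast_pow] at key
  refine key.trans (measureReal_mono fun q hq => ?_)
  refine wedge_eq_one_of_detPairing hcomm φ h ?_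
  have := hq 1
  simpa [detPairing] using this

end Abelian

/-! ### Closed forms and comparison of the bounds -/

lemma inv_pow_two_bound_eq {p : ℕ} (hp : 0 < p) :
    ((p : ℝ) ^ 2)⁻¹ + (1 - ((p : ℝ) ^ 2)⁻¹) * (p : ℝ)⁻¹ =
      ((p : ℝ) ^ 2 + p - 1) / (p : ℝ) ^ 3 := by
  have : (p : ℝ) ≠ 0 := by positivity
  field_simp
  ring

lemma inv_pow_three_bound_eq {p : ℕ} (hp : 0 < p) :
    ((p : ℝ) ^ 3)⁻¹ + (1 - ((p : ℝ) ^ 3)⁻¹) * (p : ℝ)⁻¹ =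
      ((p : ℝ) ^ 3 + p - 1) / (p : ℝ) ^ 4 := by
  have : (p : ℝ) ≠ 0 := by positivity
  field_simp
  ring

lemma inv_pow_three_bound_lt {p : ℕ} (hp : 1 < p) :
    ((p : ℝ) ^ 3)⁻¹ + (1 - ((p : ℝ) ^ 3)⁻¹) * (p : ℝ)⁻¹ <
      ((p : ℝ) ^ 2)⁻¹ + (1 - ((p : ℝ) ^ 2)⁻¹) * (p : ℝ)⁻¹ := by
  have h1 : (1 : ℝ) < p := by exact_mod_cast hp
  have h2 : (p : ℝ)⁻¹ < 1 := inv_lt_one_of_one_lt₀ h1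
  have h3 : ((p : ℝ) ^ 3)⁻¹ < ((p : ℝ) ^ 2)⁻¹ :=
    inv_strictAnti₀ (by positivity) (pow_lt_pow_right₀ h1 (by norm_num))
  nlinarith [mul_pos (sub_pos.2 h2) (sub_pos.2 h3)]

/-! ### The equality case -/

section Equality

variable {p : ℕ} [Fact p.Prime] {G : Type*} [Group G] [TopologicalSpace G] [IsTopologicalGroup G]
  [CompactSpace G] [T2Space G] [MeasurableSpace G] [BorelSpace G]
  {φ : G →* Multiplicative (ZMod p) × Multiplicative (ZMod p)}

lemma exteriorDegree_eq_iff_eq_ker (hG : IsProP p G) (hcomm : ∀ a b : G, a * b = b * a)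
    {N : Subgroup G} (hNb : N ∈ openBasis p G) (hNφ : N ≤ φ.ker) (hφ : Function.Surjective φ) :
    exteriorDegree p G = ((p : ℝ) ^ 2)⁻¹ + (1 - ((p : ℝ) ^ 2)⁻¹) * (p : ℝ)⁻¹ ↔
      exteriorCenter p G = φ.ker := by
  refine ⟨fun h => ?_, fun h => le_antisymm (exteriorDegree_le_of_surjective hNb hNφ hφ)
    (le_exteriorDegree_of_eq_ker hcomm hNb hNφ hφ h)⟩
  refine le_antisymm (exteriorCenter_le_ker hNb hNφ hφ) fun z hz y => ?_
  by_contra hzy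
  have hrad := radical_detPairing φ hφ
  -- An element of `φ.ker` outside the exterior center refines the determinant pairing to radical
  -- index at least `p ^ 3`, which gives a strict inequality.
  have h3 := (isAltPairing_detPairing φ).exteriorDegree_le_of_wedge_ne_one hG hNb
    (fun x y n hn m hm => detPairing_mul_mul φ (hNφ hn) (hNφ hm))
    (fun x y h => detPairing_eq_one_of_wedge hNb hNφ h)
    (by rw [hrad, index_ker_eq_sq φ hφ]) (hrad ▸ hz) hzy
  exact (h3.trans_lt (inv_pow_three_bound_lt (Fact.out : p.Prime).one_lt)).ne h

end Equality

end ProPExterior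

theorem corollary3p7 (p : ℕ) [Fact p.Prime] (G : Type*) [Group G] [TopologicalSpace G]
    [IsTopologicalGroup G] [CompactSpace G] [T2Space G] [MeasurableSpace G] [BorelSpace G]
    (hG : ProPExterior.IsProP p G) :
    ((∀ a b : G, a * b = b * a) → 1 < ProPExterior.rank G →
      ProPExterior.exteriorDegree p G ≤ ((p : ℝ) ^ 2 + p - 1) / (p : ℝ) ^ 3 ∧
      (ProPExterior.exteriorDegree p G = ((p : ℝ) ^ 2 + p - 1) / (p : ℝ) ^ 3 ↔
        Nonempty (G ⧸ ProPExterior.exteriorCenter p G ≃*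
          Multiplicative (ZMod p) × Multiplicative (ZMod p)))) ∧
    ((¬ ∀ a b : G, a * b = b * a) →
      ProPExterior.exteriorCenter p G ≠ Subgroup.center G →
      ProPExterior.exteriorDegree p G ≤ ((p : ℝ) ^ 3 + p - 1) / (p : ℝ) ^ 4) := by
  have hp : 0 < p := (Fact.out : p.Prime).pos
  rw [← ProPExterior.inv_pow_two_bound_eq hp, ← ProPExterior.inv_pow_three_bound_eq hp]
  refine ⟨fun hcomm hr => ?_, ProPExterior.exteriorDegree_le_of_not_comm hG⟩
  obtain ⟨N, hNb, φ, hφ, hNφ⟩ := ProPExterior.exists_surjective_of_one_lt_rank hG hcomm hr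
  exact ⟨ProPExterior.exteriorDegree_le_of_surjective hNb hNφ hφ,
    (ProPExterior.exteriorDegree_eq_iff_eq_ker hG hcomm hNb hNφ hφ).trans
      (ProPExterior.eq_ker_iff_nonempty_mulEquiv hNb hNφ hφ)⟩
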